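/- Let $S$ and $\Sigma$ be finite sets, $N=|S|$, and let $A_s\in\mathbb{R}^{n\times n}$ $(s\in S)$. Let $\mathcal{M}=(S,\hat s,\Sigma,T)$ and $\bar{\mathcal{M}}=(S,\hat s,\Sigma,\bar T)$ be Markov decision processes (for all $s,\sigma$, either $T(s,\sigma,\cdot)$ is a probability distribution on $S$, or $T(s,\sigma,\cdot)=0$, in which case $\sigma$ is unavailable at $s$; likewise for $\bar T$). Suppose that $\bar{\mathcal{M}}$ is a $\Delta$-approximation of $\mathcal{M}$: for all $s,s'\in S$ and $\sigma\in\Sigma$, $|T(s,\sigma,s')-\bar T(s,\sigma,s')|\le\Delta$, and $T(s,\sigma,s')>0$ if and only if $\bar T(s,\sigma,s')>0$. Let $\pi:S\times\Sigma\to[0,1]$ be a randomized policy, that is, $\sum_{\sigma}\pi(s,\sigma)=1$ for every $s$, and $\pi(s,\sigma)=0$ if $\sigma$ is unavailable at $s$. Let $P_{ij}=\sum_\sigma T(i,\sigma,j)\pi(i,\sigma)$ and $\bar P_{ij}=\sum_\sigma \bar T(i,\sigma,j)\pi(i,\sigma)$ be the transition matrices of the induced Markov chains. Suppose that the chain $(S,P)$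 is an ergodic unichain, i.e. it has a single communicating class of recurrent aperiodic states and all other states are transient. Let $\bar p^\infty$ be the stationary distribution of $\bar P$ and $\bar P_{jump}=1-\sum_i\bar p^\infty_i\bar P_{ii}$. Let $H^\#=(h^\#_{ij})$ be the group inverse of $H=I-\bar P$, i.e. the matrix with $HH^\#H=H$, $H^\#HH^\#=H^\#$, $HH^\#=H^\#H$. Let $0<\alpha<1$ and $\mu>1$, and suppose that there are continuous functions $V_s:\mathbb{R}^n\to\mathbb{R}$ $(s\in S)$ with $V_s(0)=0$ and $V_s(x)>0$ for $x\ne0$, such that for all $s,s'\in S$ and $x\in\mathbb{R}^n$ $$V_s(A_sx)-V_s(x)\le-\alpha V_s(x),\qquad V_s(x)\le\mu V_{s'}(x).$$ If $$\bar P_{jump}+\sum_{i}\Big[\bar p^\infty_i\Delta+\bar P_{ii}N\Delta\max_j|h^\#_{ji}|+N\Delta^2\max_j|h^\#_{ji}|\Big]\le\frac{\ln\frac1{1-\alpha}}{\ln\mu},$$ where in the degenerate case $\Delta=0$ the inequality is required to be strict, then the true system under the policy $\pi$, namely $x(k+1)=A_{s_k}x(k)$ with $(s_k)_{k\ge0}$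 the Markov chain with transition matrix $P$ and $s_0=\hat s$, is stable with probability one: for every $x(0)\in\mathbb{R}^n$, $\lim_{k\to\infty}\|x(k)\|_\infty=0$ almost surely. -/

import Mathlib

open MeasureTheory Filter Topology

/-- A Markov decision process with finite state set `S` and finite action set `Act`.
An action `σ` is either available at `s`, and then `T s σ ·` is a probability distribution,
or it is not defined at `s`, and then `T s σ ·` vanishes identically. -/
structure MDP (S Act : Type*) [Fintype S] where
  init : S
  T : S → Act → S → ℝ
  T_nonneg : ∀ s σ s', 0 ≤ T s σ s'
  T_sum : ∀ s σ, (∑ s', T s σ s' = 1) ∨ (∀ s', T s σ s' = 0)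

namespace MDP

variable {S Act : Type*} [Fintype S]

/-- The action `σ` is available at the state `s`. -/
def Available (M : MDP S Act) (s : S) (σ : Act) : Prop := ∃ s', M.T s σ s' ≠ 0

/-- A randomized policy: at every state, a probability distribution on the available actions. -/
structure IsPolicy [Fintype Act] (M : MDP S Act) (π : S → Act → ℝ) : Prop where
  nonneg : ∀ s σ, 0 ≤ π s σ
  sum_eq_one : ∀ s, ∑ σ, π s σ = 1
  eq_zero : ∀ s σ, ¬ M.Available s σ → π s σ = 0

/-- The transition matrix of the Markov chain induced by the policy `π`. -/
def inducedMatrix [Fintype Act] (M : MDP S Act) (π : S → Act → ℝ) : Matrix S S ℝ :=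
  Matrix.of fun i j => ∑ σ, M.T i σ j * π i σ

/-- `Mbar.IsApproximation Δ M`: the process `Mbar` is a `Δ`-approximation of `M`. -/
structure IsApproximation (Mbar : MDP S Act) (Δ : ℝ) (M : MDP S Act) : Prop where
  init_eq : M.init = Mbar.init
  abs_sub_le : ∀ s σ s', |M.T s σ s' - Mbar.T s σ s'| ≤ Δ
  pos_iff : ∀ s σ s', 0 < M.T s σ s' ↔ 0 < Mbar.T s σ s'

end MDP

section Chain

variable {S : Type*} [Fintype S] [DecidableEq S]

/-- `j` is accessible from `i`. -/
def Accessible (P : Matrix S S ℝ) (i j : S) : Prop := ∃ m : ℕ, 0 < (P ^ m) i j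

def Communicate (P : Matrix S S ℝ) (i j : S) : Prop := Accessible P i j ∧ Accessible P j i

/-- `i` is accessible from every state that is accessible from `i`. -/
def IsRecurrentState (P : Matrix S S ℝ) (i : S) : Prop :=
  ∀ j, Accessible P i j → Accessible P j i

/-- The greatest common divisor of the possible return times to `i` is `1`. -/
def IsAperiodicState (P : Matrix S S ℝ) (i : S) : Prop :=
  ∀ d : ℕ, (∀ m : ℕ, 0 < (P ^ m) i i → d ∣ m) → d = 1

/-- A communicating class all of whose states are recurrent and aperiodic. -/
structure IsErgodicClass (P : Matrix S S ℝ) (X : Set S) : Prop where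
  nonempty : X.Nonempty
  mem_iff : ∀ i ∈ X, ∀ j, j ∈ X ↔ Communicate P i j
  recurrent : ∀ i ∈ X, IsRecurrentState P i
  aperiodic : ∀ i ∈ X, IsAperiodicState P i

/-- A single ergodic class, and all the other states are transient. -/
def IsErgodicUnichain (P : Matrix S S ℝ) : Prop :=
  ∃ X : Set S, IsErgodicClass P X ∧ ∀ i, i ∉ X → ¬ IsRecurrentState P i

/-- `p` is a stationary distribution of the chain with transition matrix `P`. -/
structure IsStationaryDist (P : Matrix S S ℝ) (p : S → ℝ) : Prop where
  stationary : ∀ i, p i = ∑ j, p j * P j i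
  nonneg : ∀ i, 0 ≤ p i
  sum_eq_one : ∑ i, p i = 1

/-- The stationary probability of a mode jump. -/
def jumpProb (P : Matrix S S ℝ) (p : S → ℝ) : ℝ := 1 - ∑ i, p i * P i i

/-- `G` is the group inverse of the square matrix `H`. -/
structure IsGroupInverse (H G : Matrix S S ℝ) : Prop where
  mul_mul_left : H * G * H = H
  mul_mul_right : G * H * G = G
  comm : H * G = G * H

/-- The group inverse is unique (and it exists for `1 - P` with `P` row-stochastic). -/
theorem IsGroupInverse.unique {H G G' : Matrix S S ℝ} (h : IsGroupInverse H G)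
    (h' : IsGroupInverse H G') : G = G' := by
  have e1 : G * H = G' * H := by
    calc G * H = H * G := h.comm.symm
      _ = H * G' * H * G := by rw [h'.mul_mul_left]
      _ = G' * (H * H * G) := by rw [h'.comm]; simp only [Matrix.mul_assoc]
      _ = G' * (H * G * H) := by rw [Matrix.mul_assoc H H G, Matrix.mul_assoc H G H, h.comm]
      _ = G' * H := by rw [h.mul_mul_left]
  calc G = G * H * G := h.mul_mul_right.symm
    _ = G' * (H * G) := by rw [e1, Matrix.mul_assoc]
    _ = G' * (G' * H) := by rw [h.comm, e1]
    _ = G' * H * G' := by rw [Matrix.mul_assoc G' H G', h'.comm]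
    _ = G' := h'.mul_mul_right

/-- `s` is a Markov chain on the probability space `(Ω, ℙ)` with transition matrix `P`, started
at `s₀`: its finite-dimensional distributions are those of the chain. -/
structure IsMarkovChain {Ω : Type*} [MeasurableSpace Ω] (ℙ : Measure Ω) (P : Matrix S S ℝ)
    (s₀ : S) (s : ℕ → Ω → S) : Prop where
  measurableSet_eq : ∀ k i, MeasurableSet {ω | s k ω = i}
  law : ∀ (m : ℕ) (i : ℕ → S), ℙ {ω | ∀ k ≤ m, s k ω = i k} =
    if i 0 = s₀ then ENNReal.ofReal (∏ k ∈ Finset.range m, P (i k) (i (k + 1))) else 0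

/-- The error term of the jump probability: `p` is the stationary distribution of the estimated
chain `P`, and `G` is the group inverse of `1 - P`. -/
noncomputable def jumpError (P : Matrix S S ℝ) (p : S → ℝ) (G : Matrix S S ℝ) (Δ : ℝ) : ℝ :=
  ∑ i, (p i * Δ + P i i * (Fintype.card S * Δ * ⨆ j, |G j i|)
    + Fintype.card S * Δ ^ 2 * ⨆ j, |G j i|)

end Chain

section Switched

variable {S : Type*} {n : ℕ}

/-- The solution of `x (k + 1) = A_{s k} x k`, `x 0 = x₀`, along the mode sequence `s`. -/
def trajectory (A : S → Matrix (Fin n) (Fin n) ℝ) (s : ℕ → S) (x₀ : Fin n → ℝ) :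
    ℕ → Fin n → ℝ
  | 0 => x₀
  | k + 1 => (A (s k)).mulVec (trajectory A s x₀ k)

/-- The switched system with random modes `s` is stable with probability one
(`‖·‖` is the sup norm on `Fin n → ℝ`). -/
def IsStableWithProbOne {Ω : Type*} [MeasurableSpace Ω] (ℙ : Measure Ω)
    (A : S → Matrix (Fin n) (Fin n) ℝ) (s : ℕ → Ω → S) : Prop :=
  ∀ x₀ : Fin n → ℝ, ∀ᵐ ω ∂ℙ,
    Tendsto (fun k => ‖trajectory A (fun t => s t ω) x₀ k‖) atTop (𝓝 0)

/-- A (multiple) Lyapunov function candidate: each `V s` is continuous and positive definite. -/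
structure IsLyapunovCandidate (V : S → (Fin n → ℝ) → ℝ) : Prop where
  continuous : ∀ s, Continuous (V s)
  zero : ∀ s, V s 0 = 0
  pos : ∀ s x, x ≠ 0 → 0 < V s x

end Switched

/-! ### Harmonic functions, Poisson equation and stationary distribution of a finite chain -/

section FiniteChain

variable {S : Type*} [Fintype S] [DecidableEq S]

/-! Along any mode sequence, `V (s k) (x k)` is at most `V (s 0) (x 0)` times the exponential of a
sum in which each step contributes `log (1 - α)`, plus `log μ` if the mode changes
(`lyapunov_trajectory_le`). This is an additive functional of the chain with stationary mean `log (1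
- α) + log μ * jumpProb P p`, which is negative exactly when `jumpProb P p` lies below the
threshold.

Negative mean forces almost sure divergence to `-∞`. No ergodic theorem is used: a solution of the
Poisson equation yields a weight `u ≥ 1` for which the exponential moments decay geometrically
(`exists_exp_drift`), so their sum over time is finite and its terms vanish almost surely
(`ae_tendsto_atBot`). Linearity then turns decay of `V` into decay of the state
(`tendsto_norm_trajectory`).

The true jump probability is compared with the estimated one through the group inverse perturbation
formula (`IsStationaryDist.sub_eq`). For `Δ > 0` equality in this comparison would force a one-state
chain, where the two matrices coincide in a way incompatible with equality; hence the non-strict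
hypothesis suffices (`jumpProb_le_add_jumpError`). -/

theorem Accessible.refl (P : Matrix S S ℝ) (i : S) : Accessible P i i := ⟨0, by simp⟩

theorem Accessible.trans {P : Matrix S S ℝ} (hP : P ∈ Matrix.rowStochastic ℝ S) {i j k : S}
    (hij : Accessible P i j) (hjk : Accessible P j k) : Accessible P i k := by
  obtain ⟨a, ha⟩ := hij
  obtain ⟨b, hb⟩ := hjk
  refine ⟨a + b, ?_⟩
  rw [pow_add, Matrix.mul_apply]
  refine lt_of_lt_of_le (mul_pos ha hb)
    (Finset.single_le_sum (f := fun l => (P ^ a) i l * (P ^ b) l k) (fun l _ => ?_)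
      (Finset.mem_univ j))
  exact mul_nonneg ((pow_mem hP a).1 i l) ((pow_mem hP b).1 l k)

/-- In a finite chain every state leads to a recurrent state. -/
theorem exists_accessible_isRecurrentState {P : Matrix S S ℝ}
    (hP : P ∈ Matrix.rowStochastic ℝ S) (i : S) :
    ∃ j, Accessible P i j ∧ IsRecurrentState P j := by
  classical
  let reach : S → Finset S := fun j => Finset.univ.filter fun k => Accessible P j k
  -- Take a state with the smallest reachable set: whatever it reaches has the same reachable set,
  -- so leads back to it.
  obtain ⟨j, hj, hmin⟩ := Finset.exists_min_image (reach i) (fun j => (reach j).card)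
    ⟨i, by simp [reach, Accessible.refl]⟩
  have hij : Accessible P i j := by simpa [reach] using hj
  refine ⟨j, hij, fun k hjk => ?_⟩
  have hsub : reach k ⊆ reach j := fun l hl => by
    simp only [reach, Finset.mem_filter, Finset.mem_univ, true_and] at hl ⊢
    exact hjk.trans hP hl
  have heq : reach k = reach j := Finset.eq_of_subset_of_card_le hsub
    (hmin k (by simpa [reach] using hij.trans hP hjk))
  have : j ∈ reach k := by rw [heq]; simp [reach, Accessible.refl]
  simpa [reach] using this

/-- Every state leads to a recurrent one, and the recurrent states form one class. A common
accessible state is what the later arguments need, and it passes to any chain with larger support.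
-/
theorem IsErgodicUnichain.exists_forall_accessible {P : Matrix S S ℝ}
    (hP : P ∈ Matrix.rowStochastic ℝ S) (h : IsErgodicUnichain P) :
    ∃ j, ∀ i, Accessible P i j := by
  obtain ⟨X, hX, htrans⟩ := h
  obtain ⟨j, hj⟩ := hX.nonempty
  refine ⟨j, fun i => ?_⟩
  obtain ⟨k, hik, hk⟩ := exists_accessible_isRecurrentState hP i
  have hkX : k ∈ X := by
    by_contra hkX
    exact htrans k hkX hk
  exact hik.trans hP ((hX.mem_iff k hkX j).1 hj).1

theorem Accessible.of_support_subset {P Q : Matrix S S ℝ} (hP : ∀ i j, 0 ≤ P i j)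
    (hQ : Q ∈ Matrix.rowStochastic ℝ S) (h : ∀ i j, 0 < P i j → 0 < Q i j) {i j : S}
    (hij : Accessible P i j) : Accessible Q i j := by
  obtain ⟨m, hm⟩ := hij
  induction m generalizing j with
  | zero =>
    by_cases hij : i = j
    · exact hij ▸ Accessible.refl Q i
    · simp [hij] at hm
  | succ m ih =>
    rw [pow_succ, Matrix.mul_apply] at hm
    obtain ⟨k, -, hk⟩ := Finset.exists_lt_of_sum_lt (f := fun _ => (0 : ℝ)) (by simpa using hm)
    have hkj : 0 < P k j := lt_of_le_of_ne (hP k j) fun h0 => by simp [← h0] at hk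
    exact (ih (pos_of_mul_pos_left hk (hP k j))).trans hQ ⟨1, by simpa using h k j hkj⟩

/-- Maximum principle: `g a` is the average of `g` under row `a` of `P ^ m`, so the nonnegative
deficits `g a - g k` vanish wherever that row is positive. -/
theorem eq_of_accessible_of_forall_le {P : Matrix S S ℝ} (hP : P ∈ Matrix.rowStochastic ℝ S)
    {g : S → ℝ} (hg : P.mulVec g = g) {a j : S} (hmax : ∀ i, g i ≤ g a)
    (haj : Accessible P a j) : g j = g a := by
  obtain ⟨m, hm⟩ := haj
  have hgm : (P ^ m).mulVec g = g := by
    clear hm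
    induction m with
    | zero => simp
    | succ m ih => rw [pow_succ, ← Matrix.mulVec_mulVec, hg, ih]
  have hsum : ∑ k, (P ^ m) a k * (g a - g k) = 0 := by
    have h1 := congrFun hgm a
    have h2 := Matrix.sum_row_of_mem_rowStochastic (pow_mem hP m) a
    simp only [Matrix.mulVec, dotProduct] at h1
    simp only [mul_sub, Finset.sum_sub_distrib, ← Finset.sum_mul, h1, h2]
    ring
  have h0 := (Finset.sum_eq_zero_iff_of_nonneg fun k _ =>
    mul_nonneg ((pow_mem hP m).1 a k) (sub_nonneg.2 (hmax k))).1 hsum j (Finset.mem_univ j)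
  have := (mul_eq_zero.1 h0).resolve_left hm.ne'
  linarith

/-- If some state is accessible from all states, then harmonic functions are constant. -/
theorem harmonic_eq {P : Matrix S S ℝ} (hP : P ∈ Matrix.rowStochastic ℝ S) {j : S}
    (hj : ∀ i, Accessible P i j) {g : S → ℝ} (hg : P.mulVec g = g) (i : S) : g i = g j := by
  obtain ⟨a, -, ha⟩ := Finset.exists_max_image Finset.univ g ⟨j, Finset.mem_univ j⟩
  obtain ⟨b, -, hb⟩ := Finset.exists_min_image Finset.univ g ⟨j, Finset.mem_univ j⟩
  have h1 := eq_of_accessible_of_forall_le hP hg (fun i => ha i (Finset.mem_univ i)) (hj a)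
  have h2 := eq_of_accessible_of_forall_le (g := -g) hP (by rw [Matrix.mulVec_neg, hg])
    (fun i => neg_le_neg (hb i (Finset.mem_univ i))) (hj b)
  simp only [Pi.neg_apply, neg_inj] at h2
  have h3 := ha i (Finset.mem_univ i)
  have h4 := hb i (Finset.mem_univ i)
  linarith

/-- Averaging by `P` cannot decrease `g` at its minimum. Used for both `g` and `-g`, this shows that
the only constant in the range of `1 - P` is zero. -/
theorem const_eq_zero_of_sub_mulVec_eq {P : Matrix S S ℝ} (hP : P ∈ Matrix.rowStochastic ℝ S)
    [Nonempty S] {g : S → ℝ} {c : ℝ} (h : ∀ i, c ≤ g i - P.mulVec g i) : c ≤ 0 := by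
  obtain ⟨b, -, hb⟩ := Finset.exists_min_image Finset.univ g Finset.univ_nonempty
  have h1 : g b ≤ P.mulVec g b := by
    calc g b = ∑ k, P b k * g b := by
          rw [← Finset.sum_mul, Matrix.sum_row_of_mem_rowStochastic hP, one_mul]
      _ ≤ ∑ k, P b k * g k := Finset.sum_le_sum fun k _ =>
          mul_le_mul_of_nonneg_left (hb k (Finset.mem_univ k)) (hP.1 b k)
  linarith [h b]

/-- A stationary distribution together with the solutions of the Poisson equation. -/
theorem exists_isStationaryDist_poisson {P : Matrix S S ℝ} (hP : P ∈ Matrix.rowStochastic ℝ S)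
    {j : S} (hj : ∀ i, Accessible P i j) :
    ∃ p, IsStationaryDist P p ∧
      ∀ f : S → ℝ, ∃ g : S → ℝ, ∀ i, f i = g i - P.mulVec g i + ∑ k, p k * f k := by
  have : Nonempty S := ⟨j⟩
  -- The kernel of `1 - P` consists of the constants; adding evaluation at `j` makes the operator
  -- injective, hence invertible.
  let L : (S → ℝ) →ₗ[ℝ] (S → ℝ) :=
    LinearMap.id - P.mulVecLin + (LinearMap.pi fun _ => LinearMap.proj j)
  have hL : ∀ g i, L g i = g i - P.mulVec g i + g j := fun g i => by simp [L]
  have hzero : ∀ (g : S → ℝ) (c : ℝ), (∀ i, g i - P.mulVec g i = c) → c = 0 := by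
    intro g c h
    apply le_antisymm (const_eq_zero_of_sub_mulVec_eq hP fun i => (h i).ge)
    have := const_eq_zero_of_sub_mulVec_eq (g := -g) (c := -c) hP fun i => by
      rw [Matrix.mulVec_neg, ← h i]; simp only [Pi.neg_apply]; linarith
    linarith
  have hinj : Function.Injective L := by
    rw [injective_iff_map_eq_zero]
    intro g hg
    have h1 : ∀ i, g i - P.mulVec g i = - g j := fun i => by
      have := congrFun hg i
      rw [hL] at this
      simp only [Pi.zero_apply] at this
      linarith
    have h2 := hzero g _ h1
    have h3 : P.mulVec g = g := funext fun i => by have := h1 i; linarith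
    funext i
    rw [harmonic_eq hP hj h3 i, Pi.zero_apply]
    linarith
  let e := LinearEquiv.ofInjectiveEndo L hinj
  -- The value at `j` of the solution is the constant in the Poisson equation, that is, the
  -- stationary mean of `f`; the weights of `J` are the stationary distribution.
  let J : (S → ℝ) →ₗ[ℝ] ℝ := (LinearMap.proj j).comp (e.symm : (S → ℝ) →ₗ[ℝ] (S → ℝ))
  have hJ : ∀ f i, f i = e.symm f i - P.mulVec (e.symm f) i + J f := fun f i => by
    have h : L (e.symm f) = f := e.apply_symm_apply f
    rw [← congrFun h i, hL]
    simp [J]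
  have hunique : ∀ (f g : S → ℝ) (c : ℝ), (∀ i, f i = g i - P.mulVec g i + c) → J f = c := by
    intro f g c h
    have := hzero (g - e.symm f) (J f - c) fun i => by
      have h1 := h i
      have h2 := hJ f i
      rw [Matrix.mulVec_sub]
      simp only [Pi.sub_apply]
      linarith
    linarith
  have hsum : ∀ f, J f = ∑ k, J (Pi.single k 1) * f k := fun f => by
    conv_lhs => rw [← Finset.univ_sum_single f]
    rw [map_sum]
    refine Finset.sum_congr rfl fun k _ => ?_
    have : Pi.single k (f k) = f k • (Pi.single k 1 : S → ℝ) := by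
      rw [← Pi.single_smul]; simp
    rw [this, map_smul, smul_eq_mul, mul_comm]
  refine ⟨fun k => J (Pi.single k 1), ⟨fun i => ?_, fun i => ?_, ?_⟩, fun f => ⟨e.symm f, ?_⟩⟩
  · have h := hunique (Pi.single i 1 - P.mulVec (Pi.single i 1)) (Pi.single i 1) 0
      fun k => by simp
    rw [map_sub, sub_eq_zero] at h
    rw [h, hsum]
    simp
  · have := const_eq_zero_of_sub_mulVec_eq (g := e.symm (Pi.single i 1))
      (c := - J (Pi.single i 1)) hP fun k => by
        have h1 := hJ (Pi.single i 1) k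
        have h2 : (0 : ℝ) ≤ (Pi.single i 1 : S → ℝ) k := by
          by_cases h : k = i
          · subst h; simp
          · simp [h]
        linarith
    linarith
  · have := hunique 1 0 1 fun i => by simp
    rw [hsum] at this
    simpa using this
  · intro i
    rw [← hsum]
    exact hJ f i

/-! ### Perturbation of the stationary distribution and of the jump probability -/

/-- The complementary projection `Q` satisfies `P * Q = Q`, so its columns are harmonic and
therefore constant; `p Q = p` then identifies every row of `Q` with `p`. -/
theorem IsGroupInverse.mul_eq_one_sub {P G : Matrix S S ℝ} (hG : IsGroupInverse (1 - P) G)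
    (hP : P ∈ Matrix.rowStochastic ℝ S) {j : S} (hj : ∀ i, Accessible P i j) {p : S → ℝ}
    (hp : IsStationaryDist P p) (i k : S) :
    ((1 - P) * G) i k = (1 : Matrix S S ℝ) i k - p k := by
  set Q : Matrix S S ℝ := 1 - (1 - P) * G with hQ
  have h1 : P * Q = Q := by
    have : (1 - P) * Q = 0 := by
      rw [hQ, mul_sub, mul_one, hG.comm, ← mul_assoc, hG.mul_mul_left, sub_self]
    rw [sub_mul, one_mul, sub_eq_zero] at this
    exact this.symm
  have hconst : ∀ l k, Q l k = Q j k := fun l k =>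
    harmonic_eq hP hj (g := fun l => Q l k) (funext fun l => congrFun (congrFun h1 l) k) l
  have hpH : Matrix.vecMul p (1 - P) = 0 := by
    rw [Matrix.vecMul_sub, Matrix.vecMul_one, sub_eq_zero]
    exact funext hp.stationary
  have hpQ : Matrix.vecMul p Q = p := by
    rw [hQ, Matrix.vecMul_sub, Matrix.vecMul_one, ← Matrix.vecMul_vecMul, hpH,
      Matrix.zero_vecMul, sub_zero]
  have h2 : Q j k = p k := by
    have := congrFun hpQ k
    simp only [Matrix.vecMul, dotProduct, hconst _ k, ← Finset.sum_mul, hp.sum_eq_one,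
      one_mul] at this
    exact this
  have h3 : Q i k = (1 : Matrix S S ℝ) i k - ((1 - P) * G) i k := by rw [hQ]; simp
  rw [hconst i k, h2] at h3
  linarith

/-- The perturbation formula for stationary distributions. -/
theorem IsStationaryDist.sub_eq {P Pbar G : Matrix S S ℝ} (hG : IsGroupInverse (1 - Pbar) G)
    (hPbar : Pbar ∈ Matrix.rowStochastic ℝ S) {j : S} (hj : ∀ i, Accessible Pbar i j)
    {p pbar : S → ℝ} (hp : IsStationaryDist P p) (hpbar : IsStationaryDist Pbar pbar) (i : S) :
    p i - pbar i = ∑ k, p k * ∑ l, (P k l - Pbar k l) * G l i := by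
  have h1 : Matrix.vecMul p ((1 - Pbar) * G) = Matrix.vecMul p ((P - Pbar) * G) := by
    rw [← Matrix.vecMul_vecMul, ← Matrix.vecMul_vecMul, Matrix.vecMul_sub, Matrix.vecMul_sub,
      Matrix.vecMul_one]
    congr 2
    exact funext hp.stationary
  have h2 := congrFun h1 i
  simp only [Matrix.vecMul, dotProduct, hG.mul_eq_one_sub hPbar hj hpbar, mul_sub,
    Finset.sum_sub_distrib, ← Finset.sum_mul, hp.sum_eq_one, one_mul] at h2
  simpa [Matrix.one_apply, Matrix.mul_apply] using h2

theorem IsStationaryDist.abs_sub_le {P Pbar G : Matrix S S ℝ} {Δ : ℝ}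
    (hG : IsGroupInverse (1 - Pbar) G)
    (hPbar : Pbar ∈ Matrix.rowStochastic ℝ S) {j : S} (hj : ∀ i, Accessible Pbar i j)
    (hΔ : ∀ i j, |P i j - Pbar i j| ≤ Δ)
    {p pbar : S → ℝ} (hp : IsStationaryDist P p) (hpbar : IsStationaryDist Pbar pbar) (i : S) :
    |p i - pbar i| ≤ Fintype.card S * Δ * ⨆ j, |G j i| := by
  have hle : ∀ l, |G l i| ≤ ⨆ j, |G j i| := fun l =>
    le_ciSup (f := fun j => |G j i|) (Set.finite_range _).bddAbove l
  have hrow : ∀ k, |∑ l, (P k l - Pbar k l) * G l i| ≤ Fintype.card S * Δ * ⨆ j, |G j i| := by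
    intro k
    calc |∑ l, (P k l - Pbar k l) * G l i| ≤ ∑ l, |(P k l - Pbar k l) * G l i| :=
          Finset.abs_sum_le_sum_abs _ _
      _ ≤ ∑ _l : S, Δ * ⨆ j, |G j i| := Finset.sum_le_sum fun l _ => by
          rw [abs_mul]
          exact mul_le_mul (hΔ k l) (hle l) (abs_nonneg _) ((abs_nonneg _).trans (hΔ k l))
      _ = _ := by rw [Finset.sum_const, Finset.card_univ, nsmul_eq_mul, mul_assoc]
  rw [hp.sub_eq hG hPbar hj hpbar]
  calc |∑ k, p k * ∑ l, (P k l - Pbar k l) * G l i|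
      ≤ ∑ k, |p k * ∑ l, (P k l - Pbar k l) * G l i| := Finset.abs_sum_le_sum_abs _ _
    _ ≤ ∑ k, p k * (Fintype.card S * Δ * ⨆ j, |G j i|) := Finset.sum_le_sum fun k _ => by
        rw [abs_mul, abs_of_nonneg (hp.nonneg k)]
        exact mul_le_mul_of_nonneg_left (hrow k) (hp.nonneg k)
    _ = _ := by rw [← Finset.sum_mul, hp.sum_eq_one, one_mul]

/-- The jump probability of a perturbed chain; the inequality is strict unless `Δ = 0`. -/
theorem jumpProb_le_add_jumpError {P Pbar G : Matrix S S ℝ} {Δ : ℝ}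
    (hG : IsGroupInverse (1 - Pbar) G)
    (hP : P ∈ Matrix.rowStochastic ℝ S)
    (hPbar : Pbar ∈ Matrix.rowStochastic ℝ S) {j : S} (hj : ∀ i, Accessible Pbar i j)
    (hΔ : ∀ i j, |P i j - Pbar i j| ≤ Δ)
    {p pbar : S → ℝ} (hp : IsStationaryDist P p) (hpbar : IsStationaryDist Pbar pbar) :
    jumpProb P p ≤ jumpProb Pbar pbar + jumpError Pbar pbar G Δ ∧
      (0 < Δ → jumpProb P p < jumpProb Pbar pbar + jumpError Pbar pbar G Δ) := by
  have hΔ0 : 0 ≤ Δ := (abs_nonneg _).trans (hΔ j j)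
  let c : S → ℝ := fun i => Fintype.card S * Δ * ⨆ j, |G j i|
  have hc : ∀ i, |p i - pbar i| ≤ c i := hp.abs_sub_le hG hPbar hj hΔ hpbar
  have hc0 : ∀ i, 0 ≤ c i := fun i => (abs_nonneg _).trans (hc i)
  let t : S → ℝ := fun i => pbar i * Δ + Pbar i i * c i + Δ * c i -
    (pbar i * Pbar i i - p i * P i i)
  have ht : jumpProb Pbar pbar + jumpError Pbar pbar G Δ = jumpProb P p + ∑ i, t i := by
    simp only [t, c, jumpProb, jumpError, Finset.sum_add_distrib, Finset.sum_sub_distrib]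
    have : ∀ i, Δ * (Fintype.card S * Δ * ⨆ j, |G j i|) =
      Fintype.card S * Δ ^ 2 * ⨆ j, |G j i| := fun i => by ring
    simp only [this]
    ring
  -- The slack splits into products of nonnegative factors, so equality forces each product to
  -- vanish.
  have hdecomp : ∀ i, t i = pbar i * (Δ - (Pbar i i - P i i)) +
      P i i * (c i - (pbar i - p i)) + c i * (Δ - (P i i - Pbar i i)) := fun i => by
    simp only [t]; ring
  have h1 : ∀ i, 0 ≤ Δ - (Pbar i i - P i i) := fun i => by
    linarith [neg_abs_le (P i i - Pbar i i), hΔ i i]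
  have h2 : ∀ i, 0 ≤ c i - (pbar i - p i) := fun i => by
    linarith [neg_abs_le (p i - pbar i), hc i]
  have h3 : ∀ i, 0 ≤ Δ - (P i i - Pbar i i) := fun i => by
    linarith [le_abs_self (P i i - Pbar i i), hΔ i i]
  have k1 : ∀ i, 0 ≤ pbar i * (Δ - (Pbar i i - P i i)) := fun i =>
    mul_nonneg (hpbar.nonneg i) (h1 i)
  have k2 : ∀ i, 0 ≤ P i i * (c i - (pbar i - p i)) := fun i => mul_nonneg (hP.1 i i) (h2 i)
  have k3 : ∀ i, 0 ≤ c i * (Δ - (P i i - Pbar i i)) := fun i => mul_nonneg (hc0 i) (h3 i)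
  have ht0 : ∀ i, 0 ≤ t i := fun i => by rw [hdecomp]; linarith [k1 i, k2 i, k3 i]
  have hnonneg : 0 ≤ ∑ i, t i := Finset.sum_nonneg fun i _ => ht0 i
  refine ⟨by linarith, fun hpos => ?_⟩
  suffices h : ∑ i, t i ≠ 0 by
    have := lt_of_le_of_ne hnonneg h.symm
    linarith
  intro h
  have htz : ∀ i, t i = 0 := fun i =>
    (Finset.sum_eq_zero_iff_of_nonneg fun i _ => ht0 i).1 h i (Finset.mem_univ i)
  obtain ⟨i, hi⟩ : ∃ i, 0 < pbar i := by
    by_contra! hall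
    have := hpbar.sum_eq_one
    rw [Finset.sum_eq_zero fun i _ => le_antisymm (hall i) (hpbar.nonneg i)] at this
    exact zero_ne_one this
  have htzi := htz i
  rw [hdecomp] at htzi
  have e1 : Δ - (Pbar i i - P i i) = 0 :=
    (mul_eq_zero.1 (by linarith [k1 i, k2 i, k3 i] :
      pbar i * (Δ - (Pbar i i - P i i)) = 0)).resolve_left hi.ne'
  -- By `e1` the other factor equals `2 * Δ`, which is positive.
  have e3 : c i = 0 :=
    (mul_eq_zero.1 (by linarith [k1 i, k2 i, k3 i] :
      c i * (Δ - (P i i - Pbar i i)) = 0)).resolve_right (by linarith)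
  -- the `i`-th column of the group inverse vanishes, so `i` is the only state
  have hN : (0 : ℝ) < Fintype.card S := by exact_mod_cast Fintype.card_pos_iff.2 ⟨j⟩
  have hsup : ⨆ j, |G j i| = 0 := (mul_eq_zero.1 e3).resolve_left (mul_pos hN hpos).ne'
  have hcol : ∀ l, G l i = 0 := fun l => abs_nonpos_iff.1 <|
    hsup ▸ le_ciSup (f := fun j => |G j i|) (Set.finite_range _).bddAbove l
  have hone : ∀ l, (1 : Matrix S S ℝ) l i = pbar i := fun l => by
    have := hG.mul_eq_one_sub hPbar hj hpbar l i
    simp only [Matrix.mul_apply, hcol, mul_zero, Finset.sum_const_zero] at this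
    linarith
  have hsub : ∀ l, l = i := fun l => by
    by_contra hl
    have := hone l
    rw [Matrix.one_apply_ne hl] at this
    exact hi.ne this
  have huniv : (Finset.univ : Finset S) = {i} := Finset.eq_singleton_iff_unique_mem.2
    ⟨Finset.mem_univ i, fun l _ => hsub l⟩
  -- On a single state both transition probabilities are `1`, so `e1` reads `Δ = 0`.
  have q1 := Matrix.sum_row_of_mem_rowStochastic hP i
  have q2 := Matrix.sum_row_of_mem_rowStochastic hPbar i
  rw [huniv, Finset.sum_singleton] at q1 q2
  linarith

end FiniteChain

/-! ### Induced chains of a process and of its approximation -/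

namespace MDP

variable {S Act : Type*} [Fintype S] [Fintype Act]

theorem inducedMatrix_mem_rowStochastic [DecidableEq S] {M : MDP S Act} {π : S → Act → ℝ}
    (hπ : M.IsPolicy π) : M.inducedMatrix π ∈ Matrix.rowStochastic ℝ S := by
  rw [Matrix.mem_rowStochastic_iff_sum]
  refine ⟨fun i j => Finset.sum_nonneg fun σ _ => mul_nonneg (M.T_nonneg i σ j) (hπ.nonneg i σ),
    fun i => ?_⟩
  simp only [inducedMatrix, Matrix.of_apply]
  rw [Finset.sum_comm, ← hπ.sum_eq_one i]
  refine Finset.sum_congr rfl fun σ _ => ?_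
  rw [← Finset.sum_mul]
  rcases M.T_sum i σ with h | h
  · rw [h, one_mul]
  · rw [hπ.eq_zero i σ fun ⟨s', hs'⟩ => hs' (h s'), mul_zero]

namespace IsApproximation

variable {M Mbar : MDP S Act} {Δ : ℝ} {π : S → Act → ℝ}

theorem isPolicy (h : Mbar.IsApproximation Δ M) (hπ : M.IsPolicy π) : Mbar.IsPolicy π := by
  refine ⟨hπ.nonneg, hπ.sum_eq_one, fun s σ hs => hπ.eq_zero s σ fun ⟨s', hs'⟩ => hs ⟨s', ?_⟩⟩
  exact ((h.pos_iff s σ s').1 (lt_of_le_of_ne (M.T_nonneg s σ s') hs'.symm)).ne'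

theorem abs_inducedMatrix_sub_le (h : Mbar.IsApproximation Δ M) (hπ : M.IsPolicy π) (i j : S) :
    |M.inducedMatrix π i j - Mbar.inducedMatrix π i j| ≤ Δ := by
  simp only [inducedMatrix, Matrix.of_apply, ← Finset.sum_sub_distrib, ← sub_mul]
  calc |∑ σ, (M.T i σ j - Mbar.T i σ j) * π i σ|
      ≤ ∑ σ, |(M.T i σ j - Mbar.T i σ j) * π i σ| := Finset.abs_sum_le_sum_abs _ _
    _ ≤ ∑ σ, Δ * π i σ := Finset.sum_le_sum fun σ _ => by
        rw [abs_mul, abs_of_nonneg (hπ.nonneg i σ)]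
        exact mul_le_mul_of_nonneg_right (h.abs_sub_le i σ j) (hπ.nonneg i σ)
    _ = Δ := by rw [← Finset.mul_sum, hπ.sum_eq_one, mul_one]

theorem inducedMatrix_pos (h : Mbar.IsApproximation Δ M) (hπ : M.IsPolicy π) {i j : S}
    (hij : 0 < M.inducedMatrix π i j) : 0 < Mbar.inducedMatrix π i j := by
  simp only [inducedMatrix, Matrix.of_apply] at hij ⊢
  obtain ⟨σ, -, hσ⟩ := Finset.exists_lt_of_sum_lt (f := fun _ => (0 : ℝ)) (by simpa using hij)
  refine Finset.sum_pos' (fun σ _ => mul_nonneg (Mbar.T_nonneg i σ j) (hπ.nonneg i σ))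
    ⟨σ, Finset.mem_univ σ, mul_pos ((h.pos_iff i σ j).1 ?_) ?_⟩
  · exact pos_of_mul_pos_left hσ (hπ.nonneg i σ)
  · exact pos_of_mul_pos_right hσ (M.T_nonneg i σ j)

end IsApproximation

end MDP

/-! ### Exponential moments and almost sure divergence of additive functionals -/

section Drift

variable {S : Type*} [Fintype S] [DecidableEq S]

/-- A Foster-Lyapunov function for the exponential moments of an additive functional whose
mean drift is negative. -/
theorem exists_exp_drift {P : Matrix S S ℝ} (hP : P ∈ Matrix.rowStochastic ℝ S)
    [Nonempty S] {ℓ : S → S → ℝ} {g : S → ℝ} {c : ℝ} (hc : c < 0)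
    (hg : ∀ i, ∑ j, P i j * ℓ i j = g i - P.mulVec g i + c) :
    ∃ θ : ℝ, 0 < θ ∧ ∃ u : S → ℝ, (∀ i, 1 ≤ u i) ∧ ∃ ρ : ℝ, 0 ≤ ρ ∧ ρ < 1 ∧
      ∀ i, ∑ j, P i j * (Real.exp (θ * ℓ i j) * u j) ≤ ρ * u i := by
  obtain ⟨b, -, hb⟩ := Finset.exists_min_image Finset.univ g Finset.univ_nonempty
  -- The weight is the first-order corrector `1 + θ * g`, with `g` shifted by its minimum so that
  -- the weight is at least `1`. By the Poisson equation the derivative of `F i` at `0` is `c` for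
  -- every `i`.
  let F : S → ℝ → ℝ := fun i θ =>
    ∑ j, P i j * (Real.exp (θ * ℓ i j) * (1 + θ * (g j - g b))) - (1 + θ * (g i - g b))
  have hrow := Matrix.sum_row_of_mem_rowStochastic hP
  have hF0 : ∀ i, F i 0 = 0 := fun i => by simp [F, hrow]
  have hF' : ∀ i, HasDerivAt (F i) c 0 := fun i => by
    have hterm : ∀ j, HasDerivAt
        (fun θ => P i j * (Real.exp (θ * ℓ i j) * (1 + θ * (g j - g b))))
        (P i j * (ℓ i j + (g j - g b))) 0 := fun j => by
      have h1 : HasDerivAt (fun θ : ℝ => Real.exp (θ * ℓ i j)) (ℓ i j) 0 := by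
        simpa using ((hasDerivAt_id (0 : ℝ)).mul_const (ℓ i j)).exp
      have h2 : HasDerivAt (fun θ : ℝ => 1 + θ * (g j - g b)) (g j - g b) 0 := by
        simpa using ((hasDerivAt_id (0 : ℝ)).mul_const (g j - g b)).const_add 1
      simpa using (h1.mul h2).const_mul (P i j)
    have h2 : HasDerivAt (fun θ : ℝ => 1 + θ * (g i - g b)) (g i - g b) 0 := by
      simpa using ((hasDerivAt_id (0 : ℝ)).mul_const (g i - g b)).const_add 1
    refine ((HasDerivAt.fun_sum fun j _ => hterm j).sub h2).congr_deriv ?_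
    have := hg i
    simp only [Matrix.mulVec, dotProduct] at this
    simp only [mul_add, mul_sub, Finset.sum_add_distrib, Finset.sum_sub_distrib,
      ← Finset.sum_mul, hrow]
    linarith
  have hev : ∀ᶠ θ : ℝ in 𝓝[>] 0, ∀ i, F i θ < 0 := by
    rw [eventually_all]
    intro i
    have h := (hasDerivAt_iff_tendsto_slope.1 (hF' i)).eventually (gt_mem_nhds hc)
    have h' := h.filter_mono (nhdsWithin_mono (0 : ℝ) fun x (hx : 0 < x) => hx.ne')
    filter_upwards [h', self_mem_nhdsWithin] with θ hθ hpos
    rw [slope_def_field, hF0, sub_zero, sub_zero] at hθ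
    by_contra! hn
    exact absurd (div_nonneg hn (le_of_lt hpos)) (not_le.2 hθ)
  obtain ⟨θ, hθ, hpos⟩ := (hev.and self_mem_nhdsWithin).exists
  have hpos : 0 < θ := hpos
  let u : S → ℝ := fun i => 1 + θ * (g i - g b)
  have hu : ∀ i, 1 ≤ u i := fun i => by
    have := mul_nonneg hpos.le (sub_nonneg.2 (hb i (Finset.mem_univ i)))
    simp only [u]; linarith
  -- Each ratio is below `1`; with finitely many states, the largest serves as a uniform `ρ`.
  let R : S → ℝ := fun i => (∑ j, P i j * (Real.exp (θ * ℓ i j) * u j)) / u i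
  obtain ⟨a, -, ha⟩ := Finset.exists_max_image Finset.univ R Finset.univ_nonempty
  refine ⟨θ, hpos, u, hu, R a, ?_, ?_, fun i => ?_⟩
  · refine div_nonneg (Finset.sum_nonneg fun j _ => mul_nonneg (hP.1 a j) ?_) ?_
    · exact mul_nonneg (Real.exp_pos _).le (zero_le_one.trans (hu j))
    · exact zero_le_one.trans (hu a)
  · rw [div_lt_one (zero_lt_one.trans_le (hu a))]
    exact sub_neg.1 (hθ a)
  · rw [← div_le_iff₀ (zero_lt_one.trans_le (hu i))]
    exact ha i (Finset.mem_univ i)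

namespace IsMarkovChain

variable {Ω : Type*} [MeasurableSpace Ω] {ℙ : Measure Ω} {P : Matrix S S ℝ} {s₀ : S}
  {s : ℕ → Ω → S}

/-- The Markov property, in integrated form. -/
theorem lintegral_succ (hs : IsMarkovChain ℙ P s₀ s) (hP : ∀ i j, 0 ≤ P i j) (m : ℕ)
    (F : (Fin (m + 1) → S) → S → ENNReal) :
    ∫⁻ ω, F (fun t => s t ω) (s (m + 1) ω) ∂ℙ =
      ∫⁻ ω, ∑ j, ENNReal.ofReal (P (s m ω) j) * F (fun t => s t ω) j ∂ℙ := by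
  let _ : MeasurableSpace S := ⊤
  have hmeas : ∀ k, Measurable (s k) := fun k => measurable_to_countable' fun i =>
    hs.measurableSet_eq k i
  have hX : Measurable fun ω (t : Fin (m + 1)) => s t ω := measurable_pi_lambda _ fun t => hmeas t
  have hY : Measurable fun ω => ((fun t : Fin (m + 1) => s t ω), s (m + 1) ω) :=
    hX.prodMk (hmeas _)
  have hcyl : ∀ (c : Fin (m + 1) → S) (j : S),
      ℙ {ω | (fun t : Fin (m + 1) => s t ω) = c ∧ s (m + 1) ω = j} =
        ℙ {ω | (fun t : Fin (m + 1) => s t ω) = c} *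
          ENNReal.ofReal (P (c (Fin.last m)) j) := by
    intro c j
    -- Only the value `j` at time `m + 1` matters beyond the prescribed path.
    let i : ℕ → S := fun k => if h : k < m + 1 then c ⟨k, h⟩ else j
    have hlast : i m = c (Fin.last m) := by simp [i, Fin.last]
    have hsucc : i (m + 1) = j := by simp [i]
    have e1 : {ω | (fun t : Fin (m + 1) => s t ω) = c} = {ω | ∀ k ≤ m, s k ω = i k} := by
      ext ω
      simp only [Set.mem_ofPred_eq, funext_iff]
      constructor
      · intro h k hk
        have := h ⟨k, Nat.lt_succ_of_le hk⟩
        simpa only [i, dif_pos (Nat.lt_succ_of_le hk)] using this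
      · intro h t
        have := h t (Nat.lt_succ_iff.1 t.2)
        simpa only [i, dif_pos t.2] using this
    have e2 : {ω | (fun t : Fin (m + 1) => s t ω) = c ∧ s (m + 1) ω = j} =
        {ω | ∀ k ≤ m + 1, s k ω = i k} := by
      ext ω
      have := Set.ext_iff.1 e1 ω
      simp only [Set.mem_ofPred_eq] at this ⊢
      rw [this]
      constructor
      · rintro ⟨h1, h2⟩ k hk
        rcases Nat.le_succ_iff.1 hk with h | h
        · exact h1 k h
        · rw [h, h2, ← hsucc]
      · intro h
        exact ⟨fun k hk => h k (by omega), by rw [h (m + 1) le_rfl, hsucc]⟩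
    rw [e1, e2, hs.law, hs.law, Finset.prod_range_succ, hlast, hsucc,
      ENNReal.ofReal_mul (Finset.prod_nonneg fun k _ => hP _ _)]
    split_ifs <;> simp
  have hl : ∫⁻ ω, F (fun t => s t ω) (s (m + 1) ω) ∂ℙ =
      ∑ c : Fin (m + 1) → S, ∑ j, F c j * (ℙ {ω | (fun t : Fin (m + 1) => s t ω) = c} *
          ENNReal.ofReal (P (c (Fin.last m)) j)) := by
    rw [← lintegral_map (f := fun q : (Fin (m + 1) → S) × S => F q.1 q.2)
      (measurable_of_countable _) hY, lintegral_fintype, Fintype.sum_prod_type]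
    refine Finset.sum_congr rfl fun c _ => Finset.sum_congr rfl fun j _ => ?_
    rw [Measure.map_apply hY (measurableSet_singleton _), ← hcyl c j]
    congr 2
    ext ω
    simp
  have hr : ∫⁻ ω, ∑ j, ENNReal.ofReal (P (s m ω) j) * F (fun t => s t ω) j ∂ℙ =
      ∑ c : Fin (m + 1) → S, (∑ j, ENNReal.ofReal (P (c (Fin.last m)) j) * F c j) *
        ℙ {ω | (fun t : Fin (m + 1) => s t ω) = c} := by
    have := lintegral_map (μ := ℙ) (f := fun c : Fin (m + 1) → S =>
      ∑ j, ENNReal.ofReal (P (c (Fin.last m)) j) * F c j) (measurable_of_countable _) hX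
    simp only [Fin.val_last] at this
    rw [← this, lintegral_fintype]
    refine Finset.sum_congr rfl fun c _ => ?_
    rw [Measure.map_apply hX (measurableSet_singleton _)]
    rfl
  rw [hl, hr]
  refine Finset.sum_congr rfl fun c _ => ?_
  rw [Finset.sum_mul]
  refine Finset.sum_congr rfl fun j _ => ?_
  ring

/-- An additive functional of the chain tends to `-∞` as soon as its exponential moments
admit a Foster-Lyapunov function. -/
theorem ae_tendsto_atBot [IsProbabilityMeasure ℙ] (hs : IsMarkovChain ℙ P s₀ s)
    (hP : ∀ i j, 0 ≤ P i j) {ℓ : S → S → ℝ} {θ ρ : ℝ} {u : S → ℝ} (hθ : 0 < θ)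
    (hu : ∀ i, 1 ≤ u i) (hρ0 : 0 ≤ ρ) (hρ : ρ < 1)
    (hdrift : ∀ i, ∑ j, P i j * (Real.exp (θ * ℓ i j) * u j) ≤ ρ * u i) :
    ∀ᵐ ω ∂ℙ, Tendsto (fun m => ∑ t ∈ Finset.range m, ℓ (s t ω) (s (t + 1) ω)) atTop atBot := by
  let K : S → S → ENNReal := fun i j => ENNReal.ofReal (Real.exp (θ * ℓ i j))
  let U : S → ENNReal := fun i => ENNReal.ofReal (u i)
  -- The weighted exponential of the partial sum; by the Markov property its expectation shrinks by
  -- the factor `ρ` at each step.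
  let Z : ℕ → Ω → ENNReal := fun m ω =>
    (∏ t ∈ Finset.range m, K (s t ω) (s (t + 1) ω)) * U (s m ω)
  have hdrift' : ∀ i, ∑ j, ENNReal.ofReal (P i j) * (K i j * U j) ≤ ENNReal.ofReal ρ * U i := by
    intro i
    have hnn : ∀ j, 0 ≤ Real.exp (θ * ℓ i j) * u j := fun j =>
      mul_nonneg (Real.exp_pos _).le (zero_le_one.trans (hu j))
    have := ENNReal.ofReal_le_ofReal (hdrift i)
    rw [ENNReal.ofReal_sum_of_nonneg fun j _ => mul_nonneg (hP i j) (hnn j),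
      ENNReal.ofReal_mul hρ0] at this
    refine le_of_eq_of_le (Finset.sum_congr rfl fun j _ => ?_) this
    rw [ENNReal.ofReal_mul (hP i j), ENNReal.ofReal_mul (Real.exp_pos _).le]
  have hstep : ∀ m, ∫⁻ ω, Z (m + 1) ω ∂ℙ ≤ ENNReal.ofReal ρ * ∫⁻ ω, Z m ω ∂ℙ := by
    intro m
    let F : (Fin (m + 1) → S) → S → ENNReal := fun c j =>
      (∏ t : Fin m, K (c t.castSucc) (c t.succ)) * (K (c (Fin.last m)) j * U j)
    have e1 : ∀ ω, Z (m + 1) ω = F (fun t => s t ω) (s (m + 1) ω) := fun ω => by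
      simp only [Z, F]
      rw [Finset.prod_range_succ, Finset.prod_range, mul_assoc]
      rfl
    rw [lintegral_congr e1, hs.lintegral_succ hP m F,
      ← lintegral_const_mul' _ _ ENNReal.ofReal_ne_top]
    refine lintegral_mono fun ω => ?_
    have e2 : ∀ j, ENNReal.ofReal (P (s m ω) j) * F (fun t => s t ω) j =
        (∏ t ∈ Finset.range m, K (s t ω) (s (t + 1) ω)) *
          (ENNReal.ofReal (P (s m ω) j) * (K (s m ω) j * U j)) := fun j => by
      simp only [F, Finset.prod_range, Fin.val_castSucc, Fin.val_succ, Fin.val_last]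
      ring
    simp only [e2, ← Finset.mul_sum, Z]
    calc _ ≤ (∏ t ∈ Finset.range m, K (s t ω) (s (t + 1) ω)) *
          (ENNReal.ofReal ρ * U (s m ω)) := by gcongr; exact hdrift' _
      _ = _ := by ring
  have hbound : ∀ m, ∫⁻ ω, Z m ω ∂ℙ ≤ ENNReal.ofReal ρ ^ m * ∫⁻ ω, Z 0 ω ∂ℙ := by
    intro m
    induction m with
    | zero => simp
    | succ m ih =>
      refine (hstep m).trans ?_
      rw [pow_succ', mul_assoc]
      gcongr
  have hZ0 : ∫⁻ ω, Z 0 ω ∂ℙ ≠ ⊤ := by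
    refine ne_top_of_le_ne_top (b := ∑ i, U i) (ENNReal.sum_ne_top.2 fun i _ =>
      ENNReal.ofReal_ne_top) ?_
    calc ∫⁻ ω, Z 0 ω ∂ℙ ≤ ∫⁻ _, ∑ i, U i ∂ℙ := lintegral_mono fun ω => by
          simp only [Z, Finset.range_zero, Finset.prod_empty, one_mul]
          exact Finset.single_le_sum (f := U) (fun _ _ => zero_le) (Finset.mem_univ _)
      _ = ∑ i, U i := by simp
  have hmeas : ∀ m, Measurable (Z m) := by
    let _ : MeasurableSpace S := ⊤
    have hmeas : ∀ k, Measurable (s k) := fun k => measurable_to_countable' fun i =>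
      hs.measurableSet_eq k i
    intro m
    refine (Finset.measurable_fun_prod _ fun t _ => ?_).mul
      ((measurable_of_countable U).comp (hmeas m))
    exact (measurable_of_countable fun q : S × S => K q.1 q.2).comp
      ((hmeas t).prodMk (hmeas (t + 1)))
  have hsum : ∫⁻ ω, ∑' m, Z m ω ∂ℙ ≠ ⊤ := by
    rw [lintegral_tsum fun m => (hmeas m).aemeasurable]
    refine ne_top_of_le_ne_top ?_ (ENNReal.tsum_le_tsum hbound)
    rw [ENNReal.tsum_mul_right, ENNReal.tsum_geometric]
    refine ENNReal.mul_ne_top (ENNReal.inv_ne_top.2 ?_) hZ0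
    exact (tsub_pos_of_lt (by simpa using ENNReal.ofReal_lt_one.2 hρ)).ne'
  filter_upwards [ae_lt_top (Measurable.tsum hmeas) hsum] with ω hω
  have h0 : Tendsto (fun m => Z m ω) atTop (𝓝 0) :=
    ENNReal.tendsto_atTop_zero_of_tsum_ne_top hω.ne
  -- Since `u ≥ 1`, the weight can be dropped from `Z`.
  have h1 : Tendsto (fun m => ENNReal.ofReal
      (Real.exp (θ * ∑ t ∈ Finset.range m, ℓ (s t ω) (s (t + 1) ω)))) atTop (𝓝 0) := by
    refine tendsto_of_tendsto_of_tendsto_of_le_of_le tendsto_const_nhds h0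
      (fun _ => zero_le) fun m => ?_
    simp only [Z, K]
    rw [Finset.mul_sum, Real.exp_sum, ENNReal.ofReal_prod_of_nonneg fun _ _ => (Real.exp_pos _).le]
    refine le_mul_of_one_le_right zero_le ?_
    simpa [U] using hu (s m ω)
  have h2 := (ENNReal.tendsto_toReal ENNReal.zero_ne_top).comp h1
  simp only [Function.comp_def, ENNReal.toReal_ofReal (Real.exp_pos _).le,
    ENNReal.toReal_zero] at h2
  rw [Real.tendsto_exp_comp_nhds_zero] at h2
  exact (tendsto_const_mul_atBot_of_pos hθ).1 h2

end IsMarkovChain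

end Drift

/-! ### Lyapunov decay along trajectories of the switched system -/

section Switched

variable {S : Type*} {n : ℕ}

theorem trajectory_smul (A : S → Matrix (Fin n) (Fin n) ℝ) (s : ℕ → S) (r : ℝ)
    (x₀ : Fin n → ℝ) (k : ℕ) : trajectory A s (r • x₀) k = r • trajectory A s x₀ k := by
  induction k with
  | zero => rfl
  | succ k ih => simp only [trajectory, ih, Matrix.mulVec_smul]

theorem IsLyapunovCandidate.exists_forall_le [Finite S] {V : S → (Fin n → ℝ) → ℝ}
    (hV : IsLyapunovCandidate V) {ε R : ℝ} (hε : 0 < ε) :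
    ∃ c > 0, ∀ s x, ε ≤ ‖x‖ → ‖x‖ ≤ R → c ≤ V s x := by
  have hcomp : IsCompact {x : Fin n → ℝ | ε ≤ ‖x‖ ∧ ‖x‖ ≤ R} := by
    have : {x : Fin n → ℝ | ε ≤ ‖x‖ ∧ ‖x‖ ≤ R} =
        {x | ε ≤ ‖x‖} ∩ Metric.closedBall 0 R := by ext x; simp
    rw [this]
    exact (isCompact_closedBall 0 R).inter_left (isClosed_le continuous_const continuous_norm)
  have hs : ∀ s, ∃ c > 0, ∀ x, ε ≤ ‖x‖ → ‖x‖ ≤ R → c ≤ V s x := by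
    intro s
    rcases Set.eq_empty_or_nonempty {x : Fin n → ℝ | ε ≤ ‖x‖ ∧ ‖x‖ ≤ R} with he | hne
    · exact ⟨1, one_pos, fun x h1 h2 => absurd (show x ∈ {x : Fin n → ℝ | ε ≤ ‖x‖ ∧ ‖x‖ ≤ R} from ⟨h1, h2⟩)
        (Set.eq_empty_iff_forall_notMem.1 he x)⟩
    · obtain ⟨y, hy, hmin⟩ := hcomp.exists_isMinOn hne (hV.continuous s).continuousOn
      exact ⟨V s y, hV.pos s y (norm_pos_iff.1 (hε.trans_le hy.1)), fun x h1 h2 => hmin ⟨h1, h2⟩⟩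
  choose c hc hle using hs
  rcases isEmpty_or_nonempty S with hS | hS
  · exact ⟨1, one_pos, fun s => (IsEmpty.false s).elim⟩
  · obtain ⟨s₀, h₀⟩ := Finite.exists_min c
    exact ⟨c s₀, hc s₀, fun s x h1 h2 => (h₀ s).trans (hle s x h1 h2)⟩

/-- Decay of the Lyapunov functions along all trajectories with a uniform rate implies
convergence. No properness of the Lyapunov functions is needed, since the system is linear. -/
theorem tendsto_norm_trajectory [Finite S] {A : S → Matrix (Fin n) (Fin n) ℝ}
    {V : S → (Fin n → ℝ) → ℝ} (hV : IsLyapunovCandidate V) {s : ℕ → S} {w : ℕ → ℝ}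
    (hw : Tendsto w atTop (𝓝 0))
    (hdecay : ∀ x₀ k, V (s k) (trajectory A s x₀ k) ≤ w k * V (s 0) x₀) (x₀ : Fin n → ℝ) :
    Tendsto (fun k => ‖trajectory A s x₀ k‖) atTop (𝓝 0) := by
  obtain ⟨L, hL⟩ : ∃ L : ℝ, ∀ s x, ‖(A s).mulVec x‖ ≤ L * ‖x‖ := by
    have : ∀ s, ∃ L : ℝ, 0 < L ∧ ∀ x, ‖(A s).mulVec x‖ ≤ L * ‖x‖ := fun s =>
      (LinearMap.toContinuousLinearMap (A s).mulVecLin).isBoundedLinearMap.bound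
    choose L _ hL using this
    obtain ⟨B, hB⟩ := (Set.finite_range L).bddAbove
    exact ⟨B, fun s x => (hL s x).trans
      (mul_le_mul_of_nonneg_right (hB ⟨s, rfl⟩) (norm_nonneg x))⟩
  -- A trajectory leaving the unit ball must land in the shell `1 ≤ ‖x‖ ≤ max L 1`, as one step
  -- expands norms by at most `L`. There `V` is at least `c`, a level that a small enough initial
  -- state cannot reach.
  obtain ⟨c, hc, hcV⟩ := hV.exists_forall_le (R := max L 1) one_pos
  obtain ⟨C, hC⟩ := hw.bddAbove_range
  have hVnn : ∀ s x, 0 ≤ V s x := fun s x => by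
    by_cases h : x = 0
    · rw [h, hV.zero]
    · exact (hV.pos s x h).le
  -- after rescaling, the trajectory stays in the unit ball
  obtain ⟨r, hr, hVr, hxr⟩ : ∃ r : ℝ, 0 < r ∧ C * V (s 0) (r • x₀) < c ∧ ‖r • x₀‖ < 1 := by
    have hcont : Continuous fun r : ℝ => r • x₀ := continuous_id.smul continuous_const
    have h1 : Tendsto (fun r : ℝ => C * V (s 0) (r • x₀)) (𝓝[>] 0) (𝓝 0) := by
      have : Continuous fun r : ℝ => C * V (s 0) (r • x₀) :=
        continuous_const.mul ((hV.continuous (s 0)).comp hcont)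
      simpa [hV.zero] using (this.tendsto 0).mono_left nhdsWithin_le_nhds
    have h2 : Tendsto (fun r : ℝ => ‖r • x₀‖) (𝓝[>] 0) (𝓝 0) := by
      simpa using (hcont.norm.tendsto 0).mono_left nhdsWithin_le_nhds
    obtain ⟨r, ⟨h1, h2⟩, h3⟩ := (((h1.eventually (gt_mem_nhds hc)).and
      (h2.eventually (gt_mem_nhds one_pos))).and self_mem_nhdsWithin).exists
    exact ⟨r, h3, h1, h2⟩
  set y := r • x₀ with hy
  have hball : ∀ k, ‖trajectory A s y k‖ < 1 := by
    intro k
    induction k with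
    | zero => exact hxr
    | succ k ih =>
      by_contra! hge
      have hle : ‖trajectory A s y (k + 1)‖ ≤ max L 1 := by
        refine (hL (s k) _).trans ?_
        have h0 := norm_nonneg (trajectory A s y k)
        calc L * ‖trajectory A s y k‖ ≤ max L 1 * ‖trajectory A s y k‖ :=
              mul_le_mul_of_nonneg_right (le_max_left _ _) h0
          _ ≤ max L 1 * 1 := mul_le_mul_of_nonneg_left ih.le (by positivity)
          _ = max L 1 := mul_one _
      have h1 := hcV (s (k + 1)) _ hge hle
      have h2 := hdecay y (k + 1)
      have h3 := mul_le_mul_of_nonneg_right (hC ⟨k + 1, rfl⟩) (hVnn (s 0) y)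
      linarith
  have hlim : Tendsto (fun k => ‖trajectory A s y k‖) atTop (𝓝 0) := by
    rw [tendsto_order]
    refine ⟨fun a ha => Eventually.of_forall fun k => ha.trans_le (norm_nonneg _),
      fun ε hε => ?_⟩
    obtain ⟨d, hd, hdV⟩ := hV.exists_forall_le (R := 1) hε
    have hw' : Tendsto (fun k => w k * V (s 0) y) atTop (𝓝 0) := by
      simpa using hw.mul_const (V (s 0) y)
    filter_upwards [hw'.eventually (gt_mem_nhds hd)] with k hk
    by_contra! hge
    have h1 := hdV (s k) _ hge (hball k).le
    linarith [hdecay y k]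
  have hfinal := hlim.const_mul r⁻¹
  rw [mul_zero] at hfinal
  refine hfinal.congr fun k => ?_
  rw [hy, trajectory_smul, norm_smul, Real.norm_of_nonneg hr.le, inv_mul_cancel_left₀ hr.ne']

/-- Each step contracts the current function by `1 - α`; replacing it by that of the next mode costs
`μ`, and nothing when the mode is kept. -/
theorem lyapunov_trajectory_le [DecidableEq S] {A : S → Matrix (Fin n) (Fin n) ℝ}
    {V : S → (Fin n → ℝ) → ℝ} {α μ : ℝ} (hα₁ : α < 1) (hμ : 0 < μ)
    (hdecrease : ∀ s x, V s ((A s).mulVec x) - V s x ≤ -α * V s x)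
    (hjump : ∀ s s' x, V s x ≤ μ * V s' x) (s : ℕ → S) (x₀ : Fin n → ℝ) (k : ℕ) :
    V (s k) (trajectory A s x₀ k) ≤ Real.exp (∑ t ∈ Finset.range k,
      (Real.log (1 - α) + if s t = s (t + 1) then 0 else Real.log μ)) * V (s 0) x₀ := by
  induction k with
  | zero => simp [trajectory]
  | succ k ih =>
    have hstep : V (s k) (trajectory A s x₀ (k + 1)) ≤
        (1 - α) * V (s k) (trajectory A s x₀ k) := by
      have := hdecrease (s k) (trajectory A s x₀ k)
      simp only [trajectory]
      linarith
    have hα : 0 < 1 - α := by linarith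
    have hcont := hstep.trans (mul_le_mul_of_nonneg_left ih hα.le)
    rw [Finset.sum_range_succ, Real.exp_add, Real.exp_add, Real.exp_log hα]
    split_ifs with h
    · rw [← h, Real.exp_zero]
      linarith
    · have h1 := hjump (s (k + 1)) (s k) (trajectory A s x₀ (k + 1))
      have h2 := mul_le_mul_of_nonneg_left hcont hμ.le
      rw [Real.exp_log hμ]
      linarith

end Switched

/-! ### Stability from the jump probability bound -/

/-- If the stationary jump probability is small enough, then the system is stable. -/
theorem isStableWithProbOne_of_jumpProb_lt {S : Type*} [Fintype S] [DecidableEq S] {n : ℕ}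
    {A : S → Matrix (Fin n) (Fin n) ℝ} {V : S → (Fin n → ℝ) → ℝ} {α μ : ℝ}
    (hα₁ : α < 1) (hμ : 1 < μ) (hV : IsLyapunovCandidate V)
    (hdecrease : ∀ s x, V s ((A s).mulVec x) - V s x ≤ -α * V s x)
    (hjump : ∀ s s' x, V s x ≤ μ * V s' x)
    {P : Matrix S S ℝ} (hP : P ∈ Matrix.rowStochastic ℝ S) {p : S → ℝ}
    (hp : IsStationaryDist P p)
    (hpoisson : ∀ f : S → ℝ, ∃ g : S → ℝ, ∀ i, f i = g i - P.mulVec g i + ∑ k, p k * f k)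
    (hlt : jumpProb P p < Real.log (1 / (1 - α)) / Real.log μ)
    {Ω : Type*} [MeasurableSpace Ω] {ℙ : Measure Ω} [IsProbabilityMeasure ℙ]
    {s₀ : S} {s : ℕ → Ω → S} (hs : IsMarkovChain ℙ P s₀ s) :
    IsStableWithProbOne ℙ A s := by
  have : Nonempty S := ⟨s₀⟩
  let ℓ : S → S → ℝ := fun i j => Real.log (1 - α) + if i = j then 0 else Real.log μ
  have hmean : ∀ i, ∑ j, P i j * ℓ i j = Real.log (1 - α) + Real.log μ * (1 - P i i) := by
    intro i
    have hrow := Matrix.sum_row_of_mem_rowStochastic hP i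
    have : ∀ j, P i j * ℓ i j = P i j * (Real.log (1 - α) + Real.log μ) -
        if i = j then P i j * Real.log μ else 0 := fun j => by
      simp only [ℓ]; split_ifs <;> ring
    simp only [this, Finset.sum_sub_distrib, ← Finset.sum_mul, hrow, Finset.sum_ite_eq,
      Finset.mem_univ, if_true]
    ring
  obtain ⟨g, hg⟩ := hpoisson fun i => ∑ j, P i j * ℓ i j
  -- As `log (1 / (1 - α)) = -log (1 - α)`, the jump bound says exactly that this mean is negative.
  have hc : ∑ k, p k * ∑ j, P k j * ℓ k j < 0 := by
    have e : ∑ k, p k * ∑ j, P k j * ℓ k j =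
        Real.log (1 - α) + Real.log μ * jumpProb P p := by
      have : ∀ k, p k * (Real.log (1 - α) + Real.log μ * (1 - P k k)) =
          p k * (Real.log (1 - α) + Real.log μ) - Real.log μ * (p k * P k k) := fun k => by ring
      simp only [hmean, this, Finset.sum_sub_distrib, ← Finset.sum_mul, ← Finset.mul_sum,
        hp.sum_eq_one, jumpProb]
      ring
    rw [lt_div_iff₀ (Real.log_pos hμ), one_div, Real.log_inv] at hlt
    rw [e]
    linarith
  obtain ⟨θ, hθ, u, hu, ρ, hρ0, hρ, hdrift⟩ := exists_exp_drift hP hc hg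
  have hae := hs.ae_tendsto_atBot hP.1 hθ hu hρ0 hρ hdrift
  intro x₀
  filter_upwards [hae] with ω hω
  exact tendsto_norm_trajectory hV (Real.tendsto_exp_atBot.comp hω)
    (fun x k => lyapunov_trajectory_le hα₁ (zero_lt_one.trans hμ) hdecrease hjump
      (fun t => s t ω) x k) x₀

theorem mainTheorem6 {S Act : Type*} [Fintype S] [DecidableEq S] [Fintype Act] {n : ℕ}
    -- the switched linear system, its Lyapunov functions and the mode-independent conditions
    (A : S → Matrix (Fin n) (Fin n) ℝ) (V : S → (Fin n → ℝ) → ℝ) (α μ : ℝ)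
    (hα₀ : 0 < α) (hα₁ : α < 1) (hμ : 1 < μ) (hV : IsLyapunovCandidate V)
    (hdecrease : ∀ s x, V s ((A s).mulVec x) - V s x ≤ -α * V s x)
    (hjump : ∀ s s' x, V s x ≤ μ * V s' x)
    -- the true process, the estimated process and the policy
    (M Mbar : MDP S Act) (Δ : ℝ) (happrox : Mbar.IsApproximation Δ M)
    (π : S → Act → ℝ) (hπ : M.IsPolicy π)
    (hergodic : IsErgodicUnichain (M.inducedMatrix π))
    -- the stationary distribution and the group inverse of the estimated chain
    (pbar : S → ℝ) (hpbar : IsStationaryDist (Mbar.inducedMatrix π) pbar)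
    (G : Matrix S S ℝ) (hG : IsGroupInverse (1 - Mbar.inducedMatrix π) G)
    -- the bound, which is strict in the degenerate case of exact knowledge
    (hbound : jumpProb (Mbar.inducedMatrix π) pbar + jumpError (Mbar.inducedMatrix π) pbar G Δ
      ≤ Real.log (1 / (1 - α)) / Real.log μ)
    (hstrict : Δ = 0 →
      jumpProb (Mbar.inducedMatrix π) pbar + jumpError (Mbar.inducedMatrix π) pbar G Δ
        < Real.log (1 / (1 - α)) / Real.log μ)
    -- the modes of the system, governed by the true process under the policy
    {Ω : Type*} [MeasurableSpace Ω] (ℙ : Measure Ω) [IsProbabilityMeasure ℙ]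
    (s : ℕ → Ω → S) (hs : IsMarkovChain ℙ (M.inducedMatrix π) M.init s) :
    IsStableWithProbOne ℙ A s := by
  have hP := MDP.inducedMatrix_mem_rowStochastic hπ
  have hPbar := MDP.inducedMatrix_mem_rowStochastic (happrox.isPolicy hπ)
  obtain ⟨j, hj⟩ := hergodic.exists_forall_accessible hP
  have hjbar : ∀ i, Accessible (Mbar.inducedMatrix π) i j := fun i =>
    (hj i).of_support_subset hP.1 hPbar fun _ _ => happrox.inducedMatrix_pos hπ
  have hΔ := happrox.abs_inducedMatrix_sub_le hπ
  obtain ⟨p, hp, hpoisson⟩ := exists_isStationaryDist_poisson hP hj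
  obtain ⟨hle, hlt⟩ := jumpProb_le_add_jumpError hG hP hPbar hjbar hΔ hp hpbar
  refine isStableWithProbOne_of_jumpProb_lt hα₁ hμ hV hdecrease hjump hP hp hpoisson ?_ hs
  -- Strictness comes from `hstrict` when `Δ = 0`, and from the perturbation estimate otherwise.
  rcases ((abs_nonneg _).trans (hΔ j j)).eq_or_lt with h0 | hpos
  · exact hle.trans_lt (hstrict h0.symm)
  · exact (hlt hpos).trans_le hbound
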